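/- Let $\Phi\colon 2^\omega\to\omega^\omega$ be a partial computable functional with a computable stage-by-stage approximation $\Phi(Z;n)[s]$ that uses only the first $s$ bits of $Z$ (a value, once found, is kept at later stages) and satisfies the usual conventions: if $\Phi(Z;n)\downarrow[s]$, then $\Phi(Z;n)[s]\le s$ and $\Phi(Z;m)\downarrow[s]$ for all $m<n$. Let $B\subseteq\omega$, let $\mu$ be Lebesgue (fair-coin) measure on $2^\omega$, and put $$\operatorname{dom}_B=\{Z:\Phi(B\oplus Z)\text{ is total}\},\qquad D_{[a,|g|)}[g]=\{Z:(\forall k\in[a,|g|))\ \Phi(B\oplus Z;k)\downarrow[g(k)]\}\quad(g\in\omega^{<\omega}).$$ The forcing $\mathbb{P}_B$ consists of the conditions $\mathbf p=\langle f^{\mathbf p},\varepsilon^{\mathbf p}\rangle$ with $f^{\mathbf p}\in\omega^{<\omega}$ and $\varepsilon^{\mathbf p}$ a positive rational; $\mathbf q\le\mathbf p$ ($\mathbf q$ extends $\mathbf p$) means that $f^{\mathbf p}$ is an initial segment of $f^{\mathbf q}$, $\varepsilon^{\mathbf q}\le\varepsilon^{\mathbf p}$, and, if $f^{\mathbf p}\neq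 f^{\mathbf q}$, then $\mu\big(\operatorname{dom}_B\setminus D_{[|f^{\mathbf p}|,|f^{\mathbf q}|)}[f^{\mathbf q}]\big)+\varepsilon^{\mathbf q}<\varepsilon^{\mathbf p}$. A statement holds for every generic $G\subset\mathbb{P}_B$ if there is a countable family of dense subsets of $\mathbb{P}_B$ such that it holds for every filter $G$ that meets all members of the family; for such $G$, $f^G=\bigcup_{\mathbf p\in G}f^{\mathbf p}$. An oracle $X$ is of DNR degree if it computes a function $h\colon\omega\to\omega$ with $h(e)\ne\varphi_e(e)$ whenever $\varphi_e(e)\downarrow$, where $\langle\varphi_e\rangle$ is a standard enumeration of the partial computable functions; it is of PA degree if every partial computable $\{0,1\}$-valued function has a total $\{0,1\}$-valued extension computable from $X$. Then the following hold. 1. For every $\mathbf p\in\mathbb{P}_B$ there are a set $S$, c.e. in $B$, with $S\subseteq\{f^{\mathbf q}:\mathbf q\le\mathbf p\}$, and a condition $\mathbf p^*\le\mathbf p$ such that $\{\mathbf q\le\mathbf p^*: f^{\mathbf q}\in S\}$ is dense below $\mathbf p^*$. 2. If $B$ is not of DNR degree and $G\subset\mathbb{P}_B$ is generic, then $f^G$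 is a total function and $B\oplus f^G$ is not of DNR degree. 3. If $B$ is not of PA degree and $G\subset\mathbb{P}_B$ is generic, then $f^G$ is a total function and $B\oplus f^G$ is not of PA degree. -/

import Mathlib

open MeasureTheory

namespace AEDomination

noncomputable section

/-! ### Oracles, joins, reducibility -/

/-- A total function as an oracle. -/
def oracle (X : ℕ → ℕ) : Set (ℕ →. ℕ) := {fun n => Part.some (X n)}

/-- The function `ℕ → ℕ` coding a set of natural numbers (given as a point of Cantor space). -/
def charFn (B : ℕ → Bool) : ℕ → ℕ := fun n => (B n).toNat

/-- The join `X ⊕ Y`: `X` on the even numbers and `Y` on the odd numbers. -/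
def join {α : Type} (X Y : ℕ → α) : ℕ → α :=
  fun n => if n % 2 = 0 then X (n / 2) else Y (n / 2)

/-- A set of strings is c.e. in `B`: it is the domain of a function partial recursive in `B`. -/
def CEIn (B : ℕ → Bool) (S : Set (List ℕ)) : Prop :=
  RecursiveIn (oracle (charFn B)) fun g : List ℕ => Part.assert (g ∈ S) fun _ => Part.some ()

/-! ### DNR degrees and PA degrees -/

/-- `h` is diagonally non-recursive: `h e ≠ φ_e(e)` whenever `φ_e(e)` converges, where `φ_e` is the
`e`-th partial computable function. -/
def IsDNR (h : ℕ → ℕ) : Prop :=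
  ∀ e : ℕ, h e ∉ Nat.Partrec.Code.eval (Denumerable.ofNat Nat.Partrec.Code e) e

/-- The oracle `X` is of DNR degree: it computes a DNR function. -/
def HasDNRDegree (X : ℕ → ℕ) : Prop :=
  ∃ h : ℕ → ℕ, IsDNR h ∧ ComputableIn (oracle X) h

/-- The oracle `X` is of PA degree: every partial computable `{0,1}`-valued function has a total
`{0,1}`-valued extension computable in `X`. -/
def HasPADegree (X : ℕ → ℕ) : Prop :=
  ∀ ψ : ℕ →. Bool, Partrec ψ →
    ∃ h : ℕ → Bool, (∀ n, ∀ v ∈ ψ n, h n = v) ∧ ComputableIn (oracle X) h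

/-! ### Partial computable functionals -/

/-- A partial computable functional `Φ` from Cantor space to Baire space, given by its computable
approximation on finite oracle strings: `approx σ n` is the value (if any) that is computed within
`σ.length` steps from the part `σ` of the oracle. -/
structure Functional where
  approx : List Bool → ℕ → Option ℕ
  computable : Computable₂ approx
  mono : ∀ (σ τ : List Bool) (n m : ℕ), σ <+: τ → approx σ n = some m → approx τ n = some m

/-- `Φ(Z; n)[s]`, the result (if any) of the computation after `s` steps. -/
def Functional.stage (Φ : Functional) (Z : ℕ → Bool) (n s : ℕ) : Option ℕ :=
  Φ.approx ((List.range s).map Z) n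

/-- The standard conventions on stages: a value that is found by stage `s` is at most `s`, and
`Φ(Z; n)` does not converge by stage `s` unless all `Φ(Z; m)`, `m < n`, do. -/
def Functional.Standard (Φ : Functional) : Prop :=
  ∀ (Z : ℕ → Bool) (n s v : ℕ), Φ.stage Z n s = some v →
    v ≤ s ∧ ∀ m < n, (Φ.stage Z m s).isSome

/-! ### The notion of forcing -/

/-- The fair-coin (Lebesgue) measure on Cantor space. -/
def cantorMeasure : Measure (ℕ → Bool) :=
  Measure.infinitePi fun _ : ℕ => (PMF.uniformOfFintype Bool).toMeasure

instance : IsProbabilityMeasure cantorMeasure := by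
  unfold cantorMeasure; infer_instance

/-- The set of all `Z` such that `Φ(B ⊕ Z)` is total. -/
def dom (Φ : Functional) (B : ℕ → Bool) : Set (ℕ → Bool) :=
  {Z | ∀ n, ∃ s, (Φ.stage (join B Z) n s).isSome}

/-- `D_{[a, |g|)}[g]`: the set of all `Z` such that `Φ(B ⊕ Z; k)` converges by stage `g(k)` for all
`k` with `a ≤ k < |g|`. -/
def bounded (Φ : Functional) (B : ℕ → Bool) (a : ℕ) (g : List ℕ) : Set (ℕ → Bool) :=
  {Z | ∀ (k : ℕ) (hk : k < g.length), a ≤ k → (Φ.stage (join B Z) k g[k]).isSome}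

/-- A condition: a finite string of natural numbers together with a positive rational. -/
structure Condition (Φ : Functional) (B : ℕ → Bool) where
  str : List ℕ
  eps : ℚ
  eps_pos : 0 < eps

/-- `q` extends `p`. -/
def Condition.Extends {Φ : Functional} {B : ℕ → Bool} (q p : Condition Φ B) : Prop :=
  p.str <+: q.str ∧ q.eps ≤ p.eps ∧
    (p.str ≠ q.str →
      cantorMeasure.real (dom Φ B \ bounded Φ B p.str.length q.str) + (q.eps : ℝ) < (p.eps : ℝ))

theorem Condition.Extends.trans {Φ : Functional} {B : ℕ → Bool} {r q p : Condition Φ B}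
    (h : r.Extends q) (h' : q.Extends p) : r.Extends p := by
  obtain ⟨h1, h2, h3⟩ := h
  obtain ⟨h1', h2', h3'⟩ := h'
  have e2 : (r.eps : ℝ) ≤ q.eps := by exact_mod_cast h2
  have e2' : (q.eps : ℝ) ≤ p.eps := by exact_mod_cast h2'
  refine ⟨h1'.trans h1, h2.trans h2', fun hne => ?_⟩
  by_cases hpq : p.str = q.str
  · have := h3 (hpq ▸ hne)
    rw [← hpq] at this
    linarith
  by_cases hqr : q.str = r.str
  · have := h3' hpq
    rw [hqr] at this
    linarith
  have a := h3 hqr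
  have b := h3' hpq
  have sub : dom Φ B \ bounded Φ B p.str.length r.str ⊆
      (dom Φ B \ bounded Φ B p.str.length q.str) ∪
        (dom Φ B \ bounded Φ B q.str.length r.str) := by
    rintro Z ⟨hZ, hn⟩
    by_contra hc
    simp only [Set.mem_union, Set.mem_sdiff, hZ, true_and, not_or, not_not] at hc
    refine hn fun k hk hpk => ?_
    by_cases hkq : k < q.str.length
    · have := hc.1 k hkq hpk
      rwa [h1.getElem hkq] at this
    · exact hc.2 k hk (not_lt.1 hkq)
  have := (measureReal_mono (μ := cantorMeasure) sub).trans (measureReal_union_le _ _)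
  linarith

/-- The notion of forcing `ℙ_B`, ordered by extension. -/
instance (Φ : Functional) (B : ℕ → Bool) : Preorder (Condition Φ B) where
  le := Condition.Extends
  le_refl _ := ⟨List.prefix_rfl, le_rfl, fun h => absurd rfl h⟩
  le_trans _ _ _ h h' := h.trans h'

/-- `D` is dense below `p`. -/
def DenseBelow {P : Type} [Preorder P] (p : P) (D : Set P) : Prop :=
  ∀ q ≤ p, ∃ r ≤ q, r ∈ D

/-- `D` is dense. -/
def IsDense {P : Type} [Preorder P] (D : Set P) : Prop :=
  ∀ p, ∃ q ≤ p, q ∈ D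

/-- `Q` holds of every sufficiently generic filter: there are countably many dense sets such that
`Q` holds of every filter that meets all of them. -/
def ForSufficientlyGeneric {P : Type} [Preorder P] (Q : Order.PFilter P → Prop) : Prop :=
  ∃ 𝒟 : Set (Set P), 𝒟.Countable ∧ (∀ D ∈ 𝒟, IsDense D) ∧
    ∀ G : Order.PFilter P, (∀ D ∈ 𝒟, ∃ p ∈ G, p ∈ D) → Q G

/-- `f` is the function `f^G`, that is, `f` is total and its graph is the union of the strings of
the conditions in `G`. -/
def IsGenericFunction {Φ : Functional} {B : ℕ → Bool} (G : Order.PFilter (Condition Φ B))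
    (f : ℕ → ℕ) : Prop :=
  ∀ n m : ℕ, f n = m ↔ ∃ p ∈ G, p.str[n]? = some m

end

end AEDomination

open AEDomination

/-! Let `p` have string `f` and bound ε, let m be the measure of `dom Φ B`, and write D[g] for
`bounded Φ B f.length g`. A string g is that of an extension of `p` as soon as it properly extends f
and dom ∖ D[g] has measure below ε. This is not visibly enumerable from `B`, since dom is not.
However, dom is the decreasing intersection of the sets `conv Φ B n`, so these have measure below m
+ ε/4 from some n₀ on. If g is long enough, D[g] and dom both lie in one such set, and μ(D[g]) > m −
3ε/4 already gives μ(dom ∖ D[g]) < ε. As D[g] depends on finitely many bits, its measure is a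
fraction that `B` computes. So let S consist of the long g with μ(D[g]) ≥ c, for a fixed rational c
between m − 3ε/4 and m − ε/2. Below the condition with string f and bound ε/2, every long string
satisfies μ(D[g]) ≥ m − ε/2 and hence lies in S. This is `exists_ceIn_denseBelow`.

Both preservation results are instances of `forSufficientlyGeneric_not_computableIn`, where `bad n
v` says that v is not an acceptable value at n. Given a functional T, either some g in S makes T
produce a bad value on `B ⊕ g`, and an extension of `p` with string g forces this; or else T must
diverge at some n on everything below some extension of the condition with bound ε/2. Otherwise `B`
could search S for convergent computations and so compute a function that avoids all bad values
(`isDense_decides`). By the use principle `exists_approx`, it is enough to treat functionals T on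
finite strings, and there are only countably many computable ones. -/

namespace AEDomination

open Encodable Filter

/-! ### Computable bounded search -/

section BoundedSearch

variable {α : Type*} [Primcodable α]

theorem computable_find_range {p : α → ℕ → Bool} {b : α → ℕ} (hp : Computable₂ p)
    (hb : Computable b) : Computable fun a => (List.range (b a)).find? (p a) := by
  have hstep : Computable₂ fun (a : α) (q : ℕ × Option ℕ) =>
      (q.2 <|> bif p a q.1 then some q.1 else none) :=
    Primrec.option_orElse.to_comp.comp (Computable.snd.comp Computable.snd)
      (Computable.cond (hp.comp Computable.fst (Computable.fst.comp Computable.snd))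
        (Computable.option_some.comp (Computable.fst.comp Computable.snd))
        (Computable.const none))
  refine (Computable.nat_rec hb (Computable.const none) hstep).of_eq fun a => ?_
  induction b a with
  | zero => rfl
  | succ k ih =>
    rw [List.range_succ, List.find?_append, ← ih]
    cases hk : p a k <;> simp [hk]

theorem computable_all_range {p : α → ℕ → Bool} {b : α → ℕ} (hp : Computable₂ p)
    (hb : Computable b) : Computable fun a => (List.range (b a)).all (p a) := by
  have h : Computable fun a => (Nat.rec true (fun y IH => IH && p a y) (b a) : Bool) :=
    Computable.nat_rec hb (Computable.const true) <|
      (Primrec.and.to_comp.comp (Computable.snd.comp Computable.snd)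
        (hp.comp Computable.fst (Computable.fst.comp Computable.snd))).to₂
  refine h.of_eq fun a => ?_
  induction b a with
  | zero => rfl
  | succ k ih => simp [List.range_succ, ← ih]

theorem computable_countP_range {p : α → ℕ → Bool} {b : α → ℕ} (hp : Computable₂ p)
    (hb : Computable b) : Computable fun a => (List.range (b a)).countP (p a) := by
  have h : Computable fun a => (Nat.rec 0 (fun y IH => IH + (p a y).toNat) (b a) : ℕ) :=
    Computable.nat_rec hb (Computable.const 0) <|
      (Primrec.nat_add.to_comp.comp (Computable.snd.comp Computable.snd)
        ((Primrec.dom_bool Bool.toNat).to_comp.comp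
          (hp.comp Computable.fst (Computable.fst.comp Computable.snd)))).to₂
  refine h.of_eq fun a => ?_
  induction b a with
  | zero => rfl
  | succ k ih =>
    rw [List.range_succ, List.countP_append, ← ih]
    cases hk : p a k <;> simp [hk]

end BoundedSearch

/-! ### Finite approximations of oracle computations -/

/-- The initial segment of length `s` of a sequence. -/
def initSeg {α : Type*} (X : ℕ → α) (s : ℕ) : List α := (List.range s).map X

@[simp] theorem length_initSeg {α : Type*} (X : ℕ → α) (s : ℕ) : (initSeg X s).length = s := by
  simp [initSeg]

theorem initSeg_succ {α : Type*} (X : ℕ → α) (s : ℕ) : initSeg X (s + 1) = initSeg X s ++ [X s] := by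
  simp [initSeg, List.range_succ]

theorem initSeg_prefix {α : Type*} (X : ℕ → α) {s t : ℕ} (h : s ≤ t) :
    initSeg X s <+: initSeg X t := by
  induction t, h using Nat.le_induction with
  | base => exact List.prefix_rfl
  | succ t _ ih => exact ih.trans (initSeg_succ X t ▸ List.prefix_append _ _)

theorem getElem?_initSeg {α : Type*} (X : ℕ → α) {s i : ℕ} (h : i < s) :
    (initSeg X s)[i]? = some (X i) := by
  simp [initSeg, h]

theorem initSeg_congr {α : Type*} {X Y : ℕ → α} {s : ℕ} (h : ∀ i < s, X i = Y i) :
    initSeg X s = initSeg Y s :=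
  List.map_congr_left fun i hi => h i (List.mem_range.1 hi)

/-- `T` is a computable functional on finite oracle strings that never revokes a value. -/
structure IsApprox (T : List ℕ → ℕ → Option ℕ) : Prop where
  computable : Computable₂ T
  mono : ∀ {σ τ : List ℕ} {n v : ℕ}, σ <+: τ → T σ n = some v → T τ n = some v

/-- The values of `f` are those that `T` finds on initial segments of `X`. -/
structure Computes (T : List ℕ → ℕ → Option ℕ) (X : ℕ → ℕ) (f : ℕ →. ℕ) : Prop where
  sound : ∀ {s n v : ℕ}, T (initSeg X s) n = some v → v ∈ f n
  complete : ∀ {n v : ℕ}, v ∈ f n → ∃ s, T (initSeg X s) n = some v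

theorem IsApprox.mono_initSeg {T : List ℕ → ℕ → Option ℕ} (hT : IsApprox T) (X : ℕ → ℕ)
    {s t n v : ℕ} (hst : s ≤ t) (h : T (initSeg X s) n = some v) : T (initSeg X t) n = some v :=
  hT.mono (initSeg_prefix X hst) h

theorem Computes.eventually {T : List ℕ → ℕ → Option ℕ} {X : ℕ → ℕ} {f : ℕ →. ℕ}
    (h : Computes T X f) (hT : IsApprox T) {n v : ℕ} (hv : v ∈ f n) :
    ∀ᶠ s in atTop, T (initSeg X s) n = some v := by
  obtain ⟨s, hs⟩ := h.complete hv
  filter_upwards [eventually_ge_atTop s] with t ht using hT.mono_initSeg X ht hs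

theorem IsApprox.of_computable {f : ℕ → ℕ} (hf : Computable f) :
    IsApprox fun _ n => some (f n) :=
  ⟨(Computable.option_some.comp (hf.comp Computable.snd)).to₂, fun _ h => h⟩

theorem Computes.of_total {f : ℕ → ℕ} (X : ℕ → ℕ) :
    Computes (fun _ n => some (f n)) X (fun n => Part.some (f n)) :=
  ⟨fun h => by simpa [eq_comm] using h, fun h => ⟨0, by simpa [eq_comm] using h⟩⟩

theorem isApprox_pair {T U : List ℕ → ℕ → Option ℕ} (hT : IsApprox T) (hU : IsApprox U) :
    IsApprox fun σ n => (T σ n).bind fun a => (U σ n).map (Nat.pair a) where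
  computable := by
    refine Computable.option_bind hT.computable ?_
    refine Computable.option_map (α := (List ℕ × ℕ) × ℕ) (hU.computable.comp (Computable.fst.comp Computable.fst)
      (Computable.snd.comp Computable.fst)) ?_
    exact (Primrec₂.natPair.to_comp.comp (Computable.snd.comp Computable.fst) Computable.snd).to₂
  mono {σ τ n v} hp h := by
    simp only [Option.bind_eq_some_iff, Option.map_eq_some_iff] at h ⊢
    obtain ⟨a, ha, b, hb, rfl⟩ := h
    exact ⟨a, hT.mono hp ha, b, hU.mono hp hb, rfl⟩

theorem computes_pair {T U : List ℕ → ℕ → Option ℕ} (hT : IsApprox T) (hU : IsApprox U)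
    {X : ℕ → ℕ} {f g : ℕ →. ℕ} (hf : Computes T X f) (hg : Computes U X g) :
    Computes (fun σ n => (T σ n).bind fun a => (U σ n).map (Nat.pair a)) X
      (fun n => Nat.pair <$> f n <*> g n) where
  sound {s n v} h := by
    simp only [Option.bind_eq_some_iff, Option.map_eq_some_iff] at h
    obtain ⟨a, ha, b, hb, rfl⟩ := h
    have : ∃ a' ∈ f n, ∃ b' ∈ g n, Nat.pair a' b' = Nat.pair a b :=
      ⟨a, hf.sound ha, b, hg.sound hb, rfl⟩
    simpa only [Seq.seq, Part.map_eq_map, Part.bind_eq_bind, Part.mem_bind_iff, Part.mem_map_iff,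
      exists_exists_and_eq_and] using this
  complete {n v} h := by
    obtain ⟨a, ha, b, hb, rfl⟩ : ∃ a ∈ f n, ∃ b ∈ g n, Nat.pair a b = v := by
      simpa only [Seq.seq, Part.map_eq_map, Part.bind_eq_bind, Part.mem_bind_iff, Part.mem_map_iff,
        exists_exists_and_eq_and] using h
    obtain ⟨s, h1, h2⟩ := ((hf.eventually hT ha).and (hg.eventually hU hb)).exists
    exact ⟨s, by simp [h1, h2]⟩

theorem isApprox_comp {T U : List ℕ → ℕ → Option ℕ} (hT : IsApprox T) (hU : IsApprox U) :
    IsApprox fun σ n => (U σ n).bind (T σ) where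
  computable := (Computable.option_bind hU.computable
    (hT.computable.comp (Computable.fst.comp Computable.fst) Computable.snd).to₂).to₂
  mono {σ τ n v} hp h := by
    simp only [Option.bind_eq_some_iff] at h ⊢
    obtain ⟨a, ha, hb⟩ := h
    exact ⟨a, hU.mono hp ha, hT.mono hp hb⟩

theorem computes_comp {T U : List ℕ → ℕ → Option ℕ} (hT : IsApprox T) (hU : IsApprox U)
    {X : ℕ → ℕ} {f g : ℕ →. ℕ} (hf : Computes T X f) (hg : Computes U X g) :
    Computes (fun σ n => (U σ n).bind (T σ)) X (fun n => g n >>= f) where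
  sound {s n v} h := by
    simp only [Option.bind_eq_some_iff] at h
    obtain ⟨a, ha, hb⟩ := h
    exact Part.mem_bind (hg.sound ha) (hf.sound hb)
  complete {n v} h := by
    obtain ⟨a, ha, hb⟩ := Part.mem_bind_iff.1 h
    obtain ⟨s, h1, h2⟩ := ((hg.eventually hU ha).and (hf.eventually hT hb)).exists
    exact ⟨s, by simp [h1, h2]⟩

/-- Primitive recursion on finite approximations. -/
def precApprox (T U : List ℕ → ℕ → Option ℕ) (σ : List ℕ) (a n : ℕ) : Option ℕ :=
  Nat.rec (T σ a) (fun y IH => IH.bind fun i => U σ (Nat.pair a (Nat.pair y i))) n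

theorem precApprox_mono {T U : List ℕ → ℕ → Option ℕ} (hT : IsApprox T) (hU : IsApprox U)
    {σ τ : List ℕ} (hp : σ <+: τ) {a n v : ℕ} (h : precApprox T U σ a n = some v) :
    precApprox T U τ a n = some v := by
  induction n generalizing v with
  | zero => exact hT.mono hp h
  | succ n ih =>
    obtain ⟨i, hi, h'⟩ := Option.bind_eq_some_iff.1 h
    exact Option.bind_eq_some_iff.2 ⟨i, ih hi, hU.mono hp h'⟩

theorem computable_precApprox {T U : List ℕ → ℕ → Option ℕ} (hT : Computable₂ T)
    (hU : Computable₂ U) : Computable fun p : List ℕ × ℕ × ℕ => precApprox T U p.1 p.2.1 p.2.2 := by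
  have hbind : Computable₂ fun (p : List ℕ × ℕ × ℕ) (q : ℕ × Option ℕ) =>
      q.2.bind fun i => U p.1 (Nat.pair p.2.1 (Nat.pair q.1 i)) := by
    refine Computable.option_bind (Computable.snd.comp Computable.snd) ?_
    have h1 : Computable fun q : ((List ℕ × ℕ × ℕ) × (ℕ × Option ℕ)) × ℕ => q.1.1 :=
      Computable.fst.comp Computable.fst
    refine hU.comp (Computable.fst.comp h1) ?_
    refine Primrec₂.natPair.to_comp.comp (Computable.fst.comp (Computable.snd.comp h1)) ?_
    exact Primrec₂.natPair.to_comp.comp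
      (Computable.fst.comp (Computable.snd.comp Computable.fst)) Computable.snd
  exact Computable.nat_rec (Computable.snd.comp Computable.snd)
    (hT.comp Computable.fst (Computable.fst.comp Computable.snd)) hbind

theorem isApprox_prec {T U : List ℕ → ℕ → Option ℕ} (hT : IsApprox T) (hU : IsApprox U) :
    IsApprox fun σ p => precApprox T U σ p.unpair.1 p.unpair.2 where
  computable := Computable.comp (computable_precApprox hT.computable hU.computable)
    (Computable.fst.pair (Computable.unpair.comp Computable.snd))
  mono hp h := precApprox_mono hT hU hp h

theorem computes_prec {T U : List ℕ → ℕ → Option ℕ} (hT : IsApprox T) (hU : IsApprox U)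
    {X : ℕ → ℕ} {f g : ℕ →. ℕ} (hf : Computes T X f) (hg : Computes U X g) :
    Computes (fun σ p => precApprox T U σ p.unpair.1 p.unpair.2) X (fun p =>
        let (a, n) := Nat.unpair p
        n.rec (f a) fun y IH => do
          let i ← IH
          g (Nat.pair a (Nat.pair y i))) where
  sound {s p v} h := by
    rcases hp : Nat.unpair p with ⟨a, n⟩
    simp only [hp] at h ⊢
    clear hp
    induction n generalizing v with
    | zero => exact hf.sound h
    | succ n ih =>
      obtain ⟨i, hi, h'⟩ := Option.bind_eq_some_iff.1 h
      exact Part.mem_bind (ih hi) (hg.sound h')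
  complete {p v} h := by
    rcases hp : Nat.unpair p with ⟨a, n⟩
    simp only [hp] at h ⊢
    clear hp
    induction n generalizing v with
    | zero => exact hf.complete h
    | succ n ih =>
      obtain ⟨i, hi, h'⟩ := Part.mem_bind_iff.1 h
      obtain ⟨s, hs⟩ := ih hi
      obtain ⟨t, ht1, ht2⟩ := ((hg.eventually hU h').and (eventually_ge_atTop s)).exists
      exact ⟨t, Option.bind_eq_some_iff.2
        ⟨i, precApprox_mono hT hU (initSeg_prefix X ht2) hs, ht1⟩⟩

/-- Unbounded search on finite approximations. -/
def rfindApprox (T : List ℕ → ℕ → Option ℕ) (σ : List ℕ) (a : ℕ) : Option ℕ :=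
  -- An undefined value counts as 0, so the search stops at the first undefined place; the `map`
  -- then returns `none`, and no later zero is reported.
  ((List.range σ.length).find? fun n => (T σ (Nat.pair a n)).getD 0 == 0).bind fun n =>
    (T σ (Nat.pair a n)).map fun _ => n

theorem rfindApprox_eq_some {T : List ℕ → ℕ → Option ℕ} {σ : List ℕ} {a v : ℕ} :
    rfindApprox T σ a = some v ↔ v < σ.length ∧ T σ (Nat.pair a v) = some 0 ∧
      ∀ j < v, ∃ m, m ≠ 0 ∧ T σ (Nat.pair a j) = some m := by
  simp only [rfindApprox, Option.bind_eq_some_iff, List.find?_range_eq_some, Option.map_eq_some_iff]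
  constructor
  · rintro ⟨n, ⟨h1, h2, h3⟩, m, hm, rfl⟩
    refine ⟨by simpa using h2, by simpa [hm] using h1, fun j hj => ?_⟩
    have := h3 j hj
    cases hT : T σ (Nat.pair a j) with
    | none => simp [hT] at this
    | some m => exact ⟨m, by simpa [hT] using this, rfl⟩
  · rintro ⟨h1, h2, h3⟩
    refine ⟨v, ⟨by simp [h2], by simpa using h1, fun j hj => ?_⟩, 0, h2, rfl⟩
    obtain ⟨m, hm, h⟩ := h3 j hj
    simpa [h] using hm

theorem isApprox_rfind {T : List ℕ → ℕ → Option ℕ} (hT : IsApprox T) :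
    IsApprox (rfindApprox T) where
  computable := by
    have hc : Computable fun q : (List ℕ × ℕ) × ℕ => T q.1.1 (Nat.pair q.1.2 q.2) :=
      hT.computable.comp (Computable.fst.comp Computable.fst)
        (Primrec₂.natPair.to_comp.comp (Computable.snd.comp Computable.fst) Computable.snd)
    refine Computable.option_bind (α := List ℕ × ℕ) (computable_find_range ?_
      (Computable.list_length.comp Computable.fst)) ?_
    · exact (Primrec.beq.to_comp.comp (Computable.option_getD hc (Computable.const 0))
        (Computable.const 0)).to₂
    · exact (Computable.option_map hc (Computable.snd.comp Computable.fst).to₂).to₂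
  mono hp h := by
    rw [rfindApprox_eq_some] at h ⊢
    obtain ⟨h1, h2, h3⟩ := h
    exact ⟨h1.trans_le hp.length_le, hT.mono hp h2, fun j hj =>
      (h3 j hj).imp fun m hm => ⟨hm.1, hT.mono hp hm.2⟩⟩

theorem computes_rfind {T : List ℕ → ℕ → Option ℕ} (hT : IsApprox T)
    {X : ℕ → ℕ} {f : ℕ →. ℕ} (hf : Computes T X f) :
    Computes (rfindApprox T) X
      (fun a => Nat.rfind fun n => (fun m => decide (m = 0)) <$> f (Nat.pair a n)) where
  sound {s a v} h := by
    obtain ⟨-, h2, h3⟩ := rfindApprox_eq_some.1 h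
    refine Nat.mem_rfind.2 ⟨?_, fun {j} hj => ?_⟩
    · simpa using hf.sound h2
    · obtain ⟨m, hm, h⟩ := h3 j hj
      simpa using ⟨m, hf.sound h, hm⟩
  complete {a v} h := by
    obtain ⟨h1, h2⟩ := Nat.mem_rfind.1 h
    have h1 : 0 ∈ f (Nat.pair a v) := by simpa using h1
    have h2 : ∀ j < v, ∃ m, m ≠ 0 ∧ m ∈ f (Nat.pair a j) := fun j hj => by
      obtain ⟨m, hm, h⟩ : ∃ m ∈ f (Nat.pair a j), m ≠ 0 := by simpa using h2 hj
      exact ⟨m, h, hm⟩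
    -- Finitely many computations are involved, so one stage serves them all.
    have h3 : ∀ᶠ s in atTop, ∀ j ∈ Finset.range v, ∃ m, m ≠ 0 ∧
        T (initSeg X s) (Nat.pair a j) = some m := by
      refine (Filter.eventually_all_finset _).2 fun j hj => ?_
      obtain ⟨m, hm, hmf⟩ := h2 j (Finset.mem_range.1 hj)
      exact (hf.eventually hT hmf).mono fun s hs => ⟨m, hm, hs⟩
    obtain ⟨s, hs1, hs2, hs3⟩ :=
      ((hf.eventually hT h1).and (h3.and (eventually_gt_atTop v))).exists
    exact ⟨s, rfindApprox_eq_some.2 ⟨by simpa using hs3, hs1,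
      fun j hj => hs2 j (Finset.mem_range.2 hj)⟩⟩

/-- The use principle: a function that is partial recursive in `X` is computed by a computable
functional on the finite initial segments of `X`. -/
theorem exists_approx {X : ℕ → ℕ} {f : ℕ →. ℕ} (hf : Nat.RecursiveIn (oracle X) f) :
    ∃ T, IsApprox T ∧ Computes T X f := by
  induction hf with
  | zero => exact ⟨_, .of_computable (Computable.const 0), .of_total X⟩
  | succ => exact ⟨_, .of_computable Computable.succ, .of_total X⟩
  | left => exact ⟨_, .of_computable (Computable.fst.comp Computable.unpair), .of_total X⟩
  | right => exact ⟨_, .of_computable (Computable.snd.comp Computable.unpair), .of_total X⟩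
  | oracle g hg =>
    obtain rfl : g = _ := hg
    refine ⟨fun σ n => σ[n]?, ⟨Computable.list_getElem?, fun {σ τ n v} hp h => ?_⟩,
      fun {s n v} h => ?_, fun {n v} h => ?_⟩
    · obtain ⟨t, rfl⟩ := hp
      obtain ⟨hn, rfl⟩ := List.getElem?_eq_some_iff.1 h
      simp [List.getElem?_append_left hn]
    · obtain ⟨hn, rfl⟩ := List.getElem?_eq_some_iff.1 h
      simp [initSeg]
    · obtain rfl := Part.mem_some_iff.1 h
      exact ⟨n + 1, getElem?_initSeg X n.lt_succ_self⟩
  | pair _ _ ih1 ih2 =>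
    obtain ⟨T, hT, hf⟩ := ih1
    obtain ⟨U, hU, hg⟩ := ih2
    exact ⟨_, isApprox_pair hT hU, computes_pair hT hU hf hg⟩
  | comp _ _ ih1 ih2 =>
    obtain ⟨T, hT, hf⟩ := ih1
    obtain ⟨U, hU, hg⟩ := ih2
    exact ⟨_, isApprox_comp hT hU, computes_comp hT hU hf hg⟩
  | prec _ _ ih1 ih2 =>
    obtain ⟨T, hT, hf⟩ := ih1
    obtain ⟨U, hU, hg⟩ := ih2
    exact ⟨_, isApprox_prec hT hU, computes_prec hT hU hf hg⟩
  | rfind _ ih =>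
    obtain ⟨T, hT, hf⟩ := ih
    exact ⟨_, isApprox_rfind hT, computes_rfind hT hf⟩

/-- Primitive recursion on the length, appending one oracle value at each step. The first component
of the input is a dummy parameter. -/
theorem recursiveIn_initSeg (X : ℕ → ℕ) :
    Nat.RecursiveIn (oracle X) fun p => Part.some (encode (initSeg X p.unpair.2)) := by
  have hconcat : Computable fun p : ℕ =>
      encode (((decode (α := List ℕ) p.unpair.1.unpair.2.unpair.2).getD []) ++ [p.unpair.2]) := by
    have hu : Computable fun p : ℕ => p.unpair.1.unpair.2.unpair :=
      Computable.unpair.comp (Computable.snd.comp (Computable.unpair.comp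
        (Computable.fst.comp Computable.unpair)))
    refine Computable.encode.comp (Computable.list_concat.comp ?_
      (Computable.snd.comp Computable.unpair))
    exact Computable.option_getD (Computable.decode.comp (Computable.snd.comp hu))
      (Computable.const [])
  have hX : Nat.RecursiveIn (oracle X) fun q => Part.some (X q.unpair.2.unpair.1) :=
    ((Nat.RecursiveIn.oracle (O := oracle X) (fun n => Part.some (X n)) rfl).comp (Nat.RecursiveIn.left.comp Nat.RecursiveIn.right)).of_eq
      fun q => by simp
  have hid : Nat.RecursiveIn (oracle X) fun q => Part.some q :=
    (RecursiveIn.iff_nat.1 ComputableIn.id.recursiveIn)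
  have hstep := (RecursiveIn.iff_nat.1 hconcat.computableIn).comp (hid.pair hX)
  refine ((RecursiveIn.iff_nat.1
    (Computable.const (encode ([] : List ℕ))).computableIn).prec hstep).of_eq fun p => ?_
  rcases Nat.unpair p with ⟨a, n⟩
  dsimp only
  induction n with
  | zero => rfl
  | succ n ih =>
    dsimp only at ih ⊢
    rw [ih, initSeg_succ]
    simp [Seq.seq]

/-- A function whose values can be found by a computable search through the finite initial segments
of `X` is partial recursive in `X`. -/
theorem Computes.recursiveIn {R : List ℕ → ℕ → Option ℕ} {X : ℕ → ℕ} {f : ℕ →. ℕ}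
    (h : Computes R X f) (hR : Computable₂ R) : Nat.RecursiveIn (oracle X) f := by
  have hC : Computable fun p : ℕ =>
      encode (R ((decode (α := List ℕ) p.unpair.1).getD []) p.unpair.2) :=
    Computable.encode.comp (hR.comp (Computable.option_getD
      (Computable.decode.comp (Computable.fst.comp Computable.unpair)) (Computable.const []))
      (Computable.snd.comp Computable.unpair))
  have hval : Nat.RecursiveIn (oracle X)
      fun p => Part.some (encode (R (initSeg X p.unpair.2) p.unpair.1)) :=
    ((RecursiveIn.iff_nat.1 hC.computableIn).comp
      ((recursiveIn_initSeg X).pair Nat.RecursiveIn.left)).of_eq fun p => by simp [Seq.seq]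
  -- `none` has code 0 and `some v` has code v + 1, so `1 - n` vanishes exactly at codes of found
  -- values, as `rfind` requires; `Nat.pred` later recovers v.
  have hsub : Computable fun n : ℕ => 1 - n :=
    Primrec.nat_sub.to_comp.comp (Computable.const 1) Computable.id
  have hstage : Nat.RecursiveIn (oracle X) fun n => Nat.rfind fun s =>
      (Part.some (R (initSeg X s) n).isSome : Part Bool) :=
    ((RecursiveIn.iff_nat.1 hsub.computableIn).comp hval).rfind.of_eq fun n => by
      congr 1
      funext s
      cases hs : R (initSeg X s) n <;> simp [hs]
  have hid : Nat.RecursiveIn (oracle X) fun q => Part.some q :=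
    (RecursiveIn.iff_nat.1 ComputableIn.id.recursiveIn)
  refine ((RecursiveIn.iff_nat.1 Computable.pred.computableIn).comp
    (hval.comp (hid.pair hstage))).of_eq fun n => Part.ext fun v => ?_
  have key : ∀ s w, R (initSeg X s) n = some w →
      (v ∈ Part.some (Nat.pred (encode (R (initSeg X s) n))) ↔ v ∈ f n) := fun s w hw => by
    have := h.sound hw
    rw [hw]
    constructor
    · intro hv
      rw [Part.mem_some_iff] at hv
      rw [hv]
      simpa using this
    · intro hv
      simpa using Part.mem_unique hv this
  constructor
  · intro hv
    simp only [Seq.seq, Part.map_eq_map, Part.bind_eq_bind, Part.map_some, Part.bind_some,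
      Part.mem_bind_iff, Part.mem_map_iff] at hv
    obtain ⟨c, ⟨q, ⟨s, hs, rfl⟩, hc⟩, hv⟩ := hv
    obtain ⟨w, hw⟩ := Option.isSome_iff_exists.1 (by simpa using Nat.rfind_spec hs)
    simp only [Nat.unpair_pair, Part.mem_some_iff] at hc
    subst hc
    exact (key s w hw).1 hv
  · intro hv
    obtain ⟨t, ht⟩ := h.complete hv
    obtain ⟨s, hs, -⟩ := Nat.rfind_min' (p := fun s => (R (initSeg X s) n).isSome) (m := t)
      (by simp [ht])
    obtain ⟨w, hw⟩ := Option.isSome_iff_exists.1 (by simpa using Nat.rfind_spec hs)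
    simp only [Seq.seq, Part.map_eq_map, Part.bind_eq_bind, Part.map_some, Part.bind_some,
      Part.mem_bind_iff, Part.mem_map_iff]
    exact ⟨_, ⟨_, ⟨s, hs, rfl⟩, by simp⟩, (key s w hw).2 hv⟩

/-- A functional is determined by any code for it. This keeps the family of dense sets countable. -/
theorem countable_isApprox : {T | IsApprox T}.Countable := by
  have : ∀ T : {T | IsApprox T}, ∃ c : Nat.Partrec.Code, c.eval = fun n =>
      Part.bind (decode (α := List ℕ × ℕ) n) fun a : List ℕ × ℕ => (Part.some (T.1 a.1 a.2)).map encode :=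
    fun T => Nat.Partrec.Code.exists_code.1 T.2.computable
  choose c hc using this
  refine Set.countable_coe_iff.1 (Function.Injective.countable (f := c) fun T U h => ?_)
  ext σ n : 3
  have h1 := congrFun ((hc T).symm.trans ((congrArg _ h).trans (hc U))) (encode (σ, n))
  simpa using h1

/-! ### The fair-coin measure of sets that depend on finitely many bits -/

theorem measurableSet_cylinder (M : ℕ) (Y : ℕ → Bool) :
    MeasurableSet {Z : ℕ → Bool | ∀ i < M, Z i = Y i} := by
  have : {Z : ℕ → Bool | ∀ i < M, Z i = Y i} = ⋂ i, ⋂ (_ : i < M), (fun Z => Z i) ⁻¹' {Y i} := by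
    ext; simp
  rw [this]
  exact .iInter fun i => .iInter fun _ => measurable_pi_apply i (measurableSet_singleton _)

theorem cantorMeasure_cylinder (M : ℕ) (Y : ℕ → Bool) :
    cantorMeasure.real {Z : ℕ → Bool | ∀ i < M, Z i = Y i} = (2 ^ M : ℝ)⁻¹ := by
  have : {Z : ℕ → Bool | ∀ i < M, Z i = Y i} =
      Set.pi (Finset.range M : Set ℕ) fun i => {Y i} := by
    ext; simp [Set.mem_pi]
  rw [measureReal_def, this, cantorMeasure, Measure.infinitePi_pi _ fun _ _ => measurableSet_singleton _]
  simp

/-- The infinite binary sequence that starts with the binary digits of `n`. -/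
def bits (n : ℕ) : ℕ → Bool := fun i => n.testBit i

theorem exists_bits_eq (M : ℕ) (Z : ℕ → Bool) : ∃ n < 2 ^ M, ∀ i < M, Z i = bits n i :=
  ⟨Nat.ofBits fun i : Fin M => Z i, Nat.ofBits_lt_two_pow _, fun i hi => by
    simp [bits, Nat.testBit_ofBits_lt _ i hi]⟩

theorem bits_injOn {M m n : ℕ} (hm : m < 2 ^ M) (hn : n < 2 ^ M) (h : ∀ i < M, bits m i = bits n i) :
    m = n := by
  refine Nat.eq_of_testBit_eq fun i => ?_
  rcases lt_or_ge i M with hi | hi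
  · exact h i hi
  · rw [Nat.testBit_lt_two_pow (hm.trans_le (Nat.pow_le_pow_right two_pos hi)),
      Nat.testBit_lt_two_pow (hn.trans_le (Nat.pow_le_pow_right two_pos hi))]

section FiniteUse

variable {P : (ℕ → Bool) → Prop} {M : ℕ}

theorem setOf_eq_biUnion_cylinder [DecidablePred P]
    (hP : ∀ Y Z : ℕ → Bool, (∀ i < M, Y i = Z i) → P Y → P Z) : {Z | P Z} =
    ⋃ n ∈ (Finset.range (2 ^ M)).filter (fun n => P (bits n)), {Z | ∀ i < M, Z i = bits n i} := by
  ext Z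
  simp only [Set.mem_ofPred_eq, Finset.mem_filter, Finset.mem_range, Set.mem_iUnion, exists_prop]
  constructor
  · intro hZ
    obtain ⟨n, hn, h⟩ := exists_bits_eq M Z
    exact ⟨n, ⟨hn, hP _ _ h hZ⟩, h⟩
  · rintro ⟨n, ⟨-, hn⟩, h⟩
    exact hP _ _ (fun i hi => (h i hi).symm) hn

theorem measurableSet_of_finite_use
    (hP : ∀ Y Z : ℕ → Bool, (∀ i < M, Y i = Z i) → P Y → P Z) :
    MeasurableSet {Z | P Z} := by
  classical
  rw [setOf_eq_biUnion_cylinder hP]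
  exact Finset.measurableSet_biUnion _ fun n _ => measurableSet_cylinder M _

/-- The numbers below 2 ^ M index the disjoint cylinders of length M. Counting them turns measure
inequalities into arithmetic that `B` can check. -/
theorem cantorMeasure_of_finite_use [DecidablePred P]
    (hP : ∀ Y Z : ℕ → Bool, (∀ i < M, Y i = Z i) → P Y → P Z) :
    cantorMeasure.real {Z | P Z} =
    (List.range (2 ^ M)).countP (fun n => P (bits n)) / 2 ^ M := by
  rw [setOf_eq_biUnion_cylinder hP, measureReal_biUnion_finset ?_ fun n _ =>
    measurableSet_cylinder M _]
  · simp only [cantorMeasure_cylinder, Finset.sum_const, nsmul_eq_mul, div_eq_mul_inv]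
    congr 2
    rw [List.countP_eq_length_filter]
    rfl
  · intro m hm n hn hmn
    refine Set.disjoint_left.2 fun Z hZ hZ' => hmn ?_
    simp only [Finset.coe_filter, Finset.mem_range, Set.mem_ofPred_eq] at hm hn
    exact bits_injOn hm.1 hn.1 fun i hi => (hZ i hi).symm.trans (hZ' i hi)

end FiniteUse

/-! ### Sets of oracles on which the functional converges -/

theorem join_congr_right {α : Type} {X Y Z : ℕ → α} {s : ℕ} (h : ∀ i < s, Y i = Z i) :
    ∀ i < s, join X Y i = join X Z i := fun i hi => by
  simp only [join]
  split_ifs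
  · rfl
  · exact h _ ((Nat.div_le_self _ _).trans_lt hi)

theorem Functional.stage_join_congr (Φ : Functional) (B : ℕ → Bool) {Y Z : ℕ → Bool} {s : ℕ}
    (h : ∀ i < s, Y i = Z i) (k : ℕ) : Φ.stage (join B Y) k s = Φ.stage (join B Z) k s :=
  congrArg (Φ.approx · k) (initSeg_congr (join_congr_right h))

theorem Functional.stage_mono (Φ : Functional) (Z : ℕ → Bool) {k s t : ℕ} (hst : s ≤ t)
    (h : (Φ.stage Z k s).isSome) : (Φ.stage Z k t).isSome := by
  obtain ⟨v, hv⟩ := Option.isSome_iff_exists.1 h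
  exact Option.isSome_iff_exists.2 ⟨v, Φ.mono _ _ _ _ (initSeg_prefix Z hst) hv⟩

variable (Φ : Functional) (B : ℕ → Bool)

/-- The set of all `Z` such that `Φ(B ⊕ Z; k)` converges by stage `s`. -/
def convBy (k s : ℕ) : Set (ℕ → Bool) := {Z | (Φ.stage (join B Z) k s).isSome}

/-- The set of all `Z` such that `Φ(B ⊕ Z; k)` converges. -/
def conv (k : ℕ) : Set (ℕ → Bool) := ⋃ s, convBy Φ B k s

theorem measurableSet_convBy (k s : ℕ) : MeasurableSet (convBy Φ B k s) :=
  measurableSet_of_finite_use (M := s) fun _ _ h hY => by rwa [← Φ.stage_join_congr B h]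

theorem measurableSet_conv (k : ℕ) : MeasurableSet (conv Φ B k) :=
  .iUnion fun s => measurableSet_convBy Φ B k s

theorem dom_eq_iInter_conv : dom Φ B = ⋂ k, conv Φ B k := by
  ext; simp [dom, conv, convBy]

theorem measurableSet_dom : MeasurableSet (dom Φ B) :=
  dom_eq_iInter_conv Φ B ▸ .iInter fun k => measurableSet_conv Φ B k

variable {B} in
theorem bounded_congr {a M : ℕ} {g : List ℕ} (hg : ∀ x ∈ g, x ≤ M) (Y Z : ℕ → Bool)
    (h : ∀ i < M, Y i = Z i) (hY : Y ∈ bounded Φ B a g) : Z ∈ bounded Φ B a g := fun k hk hak => by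
  rw [← Φ.stage_join_congr B fun i hi => h i (hi.trans_le (hg _ (List.getElem_mem hk)))]
  exact hY k hk hak

theorem measurableSet_bounded (a : ℕ) (g : List ℕ) : MeasurableSet (bounded Φ B a g) :=
  measurableSet_of_finite_use (P := (· ∈ bounded Φ B a g)) (M := g.sum)
    (bounded_congr Φ fun _ => List.le_sum_of_mem)

theorem bounded_subset_conv {a k : ℕ} {g : List ℕ} (hk : k < g.length) (hak : a ≤ k) :
    bounded Φ B a g ⊆ conv Φ B k := fun _ hZ => Set.mem_iUnion.2 ⟨g[k], hZ k hk hak⟩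

theorem bounded_concat (g : List ℕ) (s : ℕ) :
    bounded Φ B g.length (g ++ [s]) = convBy Φ B g.length s := by
  ext Z
  constructor
  · intro h
    have := h g.length (by simp) le_rfl
    rwa [List.getElem_concat_length rfl] at this
  · intro h k hk hak
    obtain rfl : k = g.length := by
      rw [List.length_append, List.length_singleton] at hk
      omega
    rw [List.getElem_concat_length rfl]
    exact h

variable {Φ} in
theorem conv_antitone (hΦ : Φ.Standard) : Antitone (conv Φ B) := by
  intro m n hmn Z hZ
  rcases hmn.eq_or_lt with rfl | hlt
  · exact hZ
  obtain ⟨s, hs⟩ := Set.mem_iUnion.1 hZ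
  obtain ⟨v, hv⟩ := Option.isSome_iff_exists.1 hs
  exact Set.mem_iUnion.2 ⟨s, (hΦ _ _ _ _ hv).2 m hlt⟩

-- Continuity from above along the sets `conv Φ B n`, which decrease because convergence at n
-- entails convergence at all smaller arguments.
variable {Φ} in
theorem exists_forall_conv_diff_dom_lt (hΦ : Φ.Standard) {δ : ℝ} (hδ : 0 < δ) :
    ∃ n₀, ∀ n ≥ n₀, cantorMeasure.real (conv Φ B n \ dom Φ B) < δ := by
  have hanti : Antitone fun n => conv Φ B n \ dom Φ B := fun m n h =>
    Set.sdiff_subset_sdiff_left (conv_antitone B hΦ h)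
  have h := tendsto_measure_iInter_atTop (μ := cantorMeasure) (s := fun n => conv Φ B n \ dom Φ B)
    (fun n => ((measurableSet_conv Φ B n).diff (measurableSet_dom Φ B)).nullMeasurableSet) hanti
    ⟨0, measure_ne_top _ _⟩
  have h0 : ⋂ n, conv Φ B n \ dom Φ B = ∅ := by
    rw [dom_eq_iInter_conv]
    ext Z
    simp only [Set.mem_iInter, Set.mem_sdiff, Set.mem_empty_iff_false, iff_false]
    exact fun h => (h 0).2 fun n => (h n).1
  rw [h0, measure_empty] at h
  have h' := ((ENNReal.tendsto_toReal ENNReal.zero_ne_top).comp h).eventually_lt_const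
    (u := δ) (by simpa using hδ)
  exact eventually_atTop.1 h'

theorem exists_dom_diff_convBy_lt (k : ℕ) {δ : ℝ} (hδ : 0 < δ) :
    ∃ s, cantorMeasure.real (dom Φ B \ convBy Φ B k s) < δ := by
  have hanti : Antitone fun s => dom Φ B \ convBy Φ B k s := fun s t h =>
    Set.sdiff_subset_sdiff_right fun Z hZ => Φ.stage_mono _ h hZ
  have h := tendsto_measure_iInter_atTop (μ := cantorMeasure) (s := fun s => dom Φ B \ convBy Φ B k s)
    (fun s => ((measurableSet_dom Φ B).diff (measurableSet_convBy Φ B k s)).nullMeasurableSet) hanti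
    ⟨0, measure_ne_top _ _⟩
  have h0 : ⋂ s, dom Φ B \ convBy Φ B k s = ∅ := by
    ext Z
    simp only [Set.mem_iInter, Set.mem_sdiff, Set.mem_empty_iff_false, iff_false]
    intro h
    obtain ⟨s, hs⟩ := (h 0).1 k
    exact (h s).2 hs
  rw [h0, measure_empty] at h
  have h' := ((ENNReal.tendsto_toReal ENNReal.zero_ne_top).comp h).eventually_lt_const
    (u := δ) (by simpa using hδ)
  exact h'.exists

/-! ### Long conditions are dense -/

variable {Φ B}

/-- The appended stage s is so late that less than half of ε is lost from dom; the other half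
becomes the new bound. -/
theorem Condition.exists_le_length_succ (p : Condition Φ B) :
    ∃ q ≤ p, q.str.length = p.str.length + 1 := by
  have hp : (0 : ℝ) < p.eps := by exact_mod_cast p.eps_pos
  obtain ⟨s, hs⟩ := exists_dom_diff_convBy_lt Φ B p.str.length (half_pos hp)
  refine ⟨⟨p.str ++ [s], p.eps / 2, half_pos p.eps_pos⟩,
    ⟨List.prefix_append _ _, (half_lt_self p.eps_pos).le, fun _ => ?_⟩, by simp⟩
  rw [bounded_concat]
  push_cast
  linarith

theorem Condition.exists_le_length (p : Condition Φ B) (n : ℕ) :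
    ∃ q ≤ p, n ≤ q.str.length := by
  induction n with
  | zero => exact ⟨p, le_rfl, Nat.zero_le _⟩
  | succ n ih =>
    obtain ⟨q, hq, hn⟩ := ih
    obtain ⟨r, hr, h⟩ := q.exists_le_length_succ
    exact ⟨r, hr.trans hq, by omega⟩

/-! ### Deciding from `B` that the functional converges with large measure -/

theorem primrec_pow : Primrec₂ ((· ^ ·) : ℕ → ℕ → ℕ) := Primrec₂.unpaired'.1 Nat.Primrec.pow

theorem primrec_testBit : Primrec₂ Nat.testBit := by
  refine (PrimrecPred.decide (p := fun p : ℕ × ℕ => p.1 / 2 ^ p.2 % 2 = 1) ?_).of_eq fun p => ?_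
  · exact Primrec.eq.comp (Primrec.nat_mod.comp (Primrec.nat_div.comp Primrec.fst
      (primrec_pow.comp (Primrec.const 2) Primrec.snd)) (Primrec.const 2)) (Primrec.const 1)
  · exact Nat.testBit_eq_decide_div_mod_eq.symm

/-- The initial segment of length `s` of the join of the set with characteristic string `σ` and the
binary digits of `n`. -/
def joinBits (σ : List ℕ) (n s : ℕ) : List Bool :=
  (List.range s).map fun i => if i % 2 = 0 then σ.getD (i / 2) 0 == 1 else n.testBit (i / 2)

theorem primrec_joinBits : Primrec fun p : List ℕ × ℕ × ℕ => joinBits p.1 p.2.1 p.2.2 := by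
  have hhalf : Primrec fun q : (List ℕ × ℕ × ℕ) × ℕ => q.2 / 2 :=
    Primrec.nat_div.comp Primrec.snd (Primrec.const 2)
  refine Primrec.list_map (Primrec.list_range.comp (Primrec.snd.comp Primrec.snd)) ?_
  refine Primrec.ite (α := (List ℕ × ℕ × ℕ) × ℕ)
    (Primrec.eq.comp (Primrec.nat_mod.comp Primrec.snd (Primrec.const 2)) (Primrec.const 0))
    (Primrec.beq.comp ((Primrec.list_getD 0).comp (Primrec.fst.comp Primrec.fst) hhalf)
      (Primrec.const 1))
    (primrec_testBit.comp (Primrec.fst.comp (Primrec.snd.comp Primrec.fst)) hhalf)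

theorem joinBits_initSeg (B : ℕ → Bool) (n : ℕ) {s t : ℕ} (h : s ≤ t) :
    joinBits (initSeg (charFn B) t) n s = initSeg (join B (bits n)) s := by
  refine List.map_congr_left fun i hi => ?_
  have hi' : i / 2 < t := (Nat.div_le_self i 2).trans_lt ((List.mem_range.1 hi).trans_le h)
  simp only [join, bits, List.getD_eq_getElem?_getD, getElem?_initSeg _ hi', charFn]
  split_ifs
  · cases B (i / 2) <;> rfl
  · rfl

variable (Φ : Functional)

/-- The test whether the set coded by `n` belongs to `bounded Φ B a g`, where `σ` is an initial
segment of `B`. -/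
def boundedTest (a : ℕ) (σ g : List ℕ) (n : ℕ) : Bool :=
  (List.range g.length).all fun k =>
    decide (k < a) || (Φ.approx (joinBits σ n (g.getD k 0)) k).isSome

theorem computable_boundedTest (a : ℕ) :
    Computable₂ fun (p : List ℕ × List ℕ) (n : ℕ) => boundedTest Φ a p.1 p.2 n := by
  refine computable_all_range (α := (List ℕ × List ℕ) × ℕ) ?_
    (Computable.list_length.comp (Computable.snd.comp Computable.fst))
  refine Primrec.or.to_comp.comp (α := ((List ℕ × List ℕ) × ℕ) × ℕ)
    ((Primrec.nat_lt.decide.comp Primrec.snd (Primrec.const a)).to_comp) ?_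
  refine Primrec.option_isSome.to_comp.comp (Φ.computable.comp ?_ Computable.snd)
  exact (primrec_joinBits.comp ((Primrec.fst.comp (Primrec.fst.comp Primrec.fst)).pair
    ((Primrec.snd.comp Primrec.fst).pair ((Primrec.list_getD 0).comp
      (Primrec.snd.comp (Primrec.fst.comp Primrec.fst)) Primrec.snd)))).to_comp

theorem boundedTest_initSeg (B : ℕ → Bool) (a : ℕ) {g : List ℕ} {s : ℕ} (hg : ∀ x ∈ g, x ≤ s)
    (n : ℕ) : boundedTest Φ a (initSeg (charFn B) s) g n = true ↔ bits n ∈ bounded Φ B a g := by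
  simp only [boundedTest, List.all_eq_true, List.mem_range, Bool.or_eq_true, decide_eq_true_eq]
  refine forall₂_congr fun k hk => ?_
  rw [List.getD_eq_getElem _ _ hk, joinBits_initSeg B n (hg _ (List.getElem_mem hk)),
    ← not_le, ← imp_iff_not_or]
  rfl

/-- The strings `g` that properly extend `f`, have length at least `l`, and for which
`D_{[|f|, |g|)}[g]` has measure at least `u / w`. -/
def largeSet (B : ℕ → Bool) (f : List ℕ) (l u w : ℕ) : Set (List ℕ) :=
  {g | (f <+: g ∧ f.length < g.length ∧ l ≤ g.length) ∧
    (u : ℝ) / w ≤ cantorMeasure.real (bounded Φ B f.length g)}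

/-- The test whether `g` belongs to `largeSet Φ B f l u w`, where `σ` is an initial segment of `B`
whose length bounds the entries of `g`. -/
def largeTest (f : List ℕ) (l u w : ℕ) (σ g : List ℕ) : Bool :=
  (decide (g.take f.length = f ∧ f.length < g.length ∧ l ≤ g.length) &&
    decide (∀ x ∈ g, x ≤ σ.length)) &&
    -- The inequality u / w ≤ count / 2 ^ |σ|, cross-multiplied. The bound on the entries of g
    -- ensures that |σ| bits of each oracle suffice.
    decide (u * 2 ^ σ.length ≤
      (List.range (2 ^ σ.length)).countP (boundedTest Φ f.length σ g) * w)

theorem computable_largeTest (f : List ℕ) (l u w : ℕ) : Computable₂ (largeTest Φ f l u w) := by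
  have hlen : Primrec fun p : List ℕ × List ℕ => p.2.length :=
    Primrec.list_length.comp Primrec.snd
  have hpow : Primrec fun p : List ℕ × List ℕ => 2 ^ p.1.length :=
    primrec_pow.comp (Primrec.const 2) (Primrec.list_length.comp Primrec.fst)
  refine Primrec.and.to_comp.comp (Primrec.and.comp ?_ ?_).to_comp ?_
  · refine PrimrecPred.decide (.and (Primrec.eq.comp (Primrec.list_take.comp
      (Primrec.const f.length) Primrec.snd) (Primrec.const f)) (.and ?_ ?_))
    · exact Primrec.nat_lt.comp (Primrec.const _) hlen
    · exact Primrec.nat_le.comp (Primrec.const _) hlen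
  · exact PrimrecPred.decide (PrimrecRel.comp (PrimrecRel.forall_mem_list Primrec.nat_le)
      Primrec.snd (Primrec.list_length.comp Primrec.fst))
  · exact Primrec.nat_le.decide.to_comp.comp
      (Primrec.nat_mul.comp (Primrec.const u) hpow).to_comp
      (Primrec.nat_mul.to_comp.comp (computable_countP_range (computable_boundedTest Φ f.length)
        hpow.to_comp) (Computable.const w))

theorem largeTest_initSeg (B : ℕ → Bool) (f : List ℕ) (l u : ℕ) {w : ℕ} (hw : 0 < w) (s : ℕ)
    (g : List ℕ) : largeTest Φ f l u w (initSeg (charFn B) s) g = true ↔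
      (∀ x ∈ g, x ≤ s) ∧ g ∈ largeSet Φ B f l u w := by
  classical
  simp only [largeTest, Bool.and_eq_true, decide_eq_true_eq, length_initSeg, largeSet]
  rw [and_comm (b := ∀ x ∈ g, x ≤ s), and_assoc]
  refine and_congr_right fun hg => and_congr ?_ ?_
  · rw [List.prefix_iff_eq_take, eq_comm]
  · have hcount : (List.range (2 ^ s)).countP (boundedTest Φ f.length (initSeg (charFn B) s) g) =
        (List.range (2 ^ s)).countP (fun n => bits n ∈ bounded Φ B f.length g) :=
      List.countP_congr fun n _ => by simp [boundedTest_initSeg Φ B f.length hg]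
    have hmeas := cantorMeasure_of_finite_use (P := (· ∈ bounded Φ B f.length g)) (M := s)
      (bounded_congr Φ hg)
    change _ ↔ _ ≤ cantorMeasure.real {Z | Z ∈ bounded Φ B f.length g}
    rw [hmeas, hcount, div_le_div_iff₀ (by exact_mod_cast hw) (by positivity)]
    norm_cast

/-- The test need not be monotone in s: one success at any stage is enough for membership. -/
theorem ceIn_of_test {B : ℕ → Bool} {S : Set (List ℕ)} {c : List ℕ → List ℕ → Bool}
    (hc : Computable₂ c) (h : ∀ g, g ∈ S ↔ ∃ s, c (initSeg (charFn B) s) g = true) : CEIn B S := by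
  refine Computes.recursiveIn (R := fun σ n => (decode (α := List ℕ) n).bind fun g =>
    bif c σ g then some (encode ()) else none) ⟨fun {s n v} hv => ?_, fun {n v} hv => ?_⟩ ?_
  · obtain ⟨g, hg, hv⟩ := Option.bind_eq_some_iff.1 hv
    obtain rfl : Denumerable.ofNat (List ℕ) n = g := by simpa using hg
    cases hcg : c (initSeg (charFn B) s) (Denumerable.ofNat (List ℕ) n) with
    | false => simp [hcg] at hv
    | true =>
      have hS := (h _).2 ⟨s, hcg⟩
      simp only [hcg, cond_true, Option.some.injEq] at hv
      simpa [← hv, hS] using ⟨(), rfl⟩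
  · simp only [Part.mem_bind_iff, Part.mem_map_iff, Part.mem_coe, Option.mem_def,
      Part.mem_assert_iff] at hv
    obtain ⟨g, hg, x, ⟨hS, -⟩, rfl⟩ := hv
    obtain rfl : Denumerable.ofNat (List ℕ) n = g := by simpa using hg
    obtain ⟨s, hs⟩ := (h _).1 hS
    exact ⟨s, by simp only [hg, Option.bind_some, hs, cond_true]⟩
  · refine Computable.option_bind (Computable.decode.comp Computable.snd) ?_
    exact Computable.cond (α := (List ℕ × ℕ) × List ℕ)
      (hc.comp (Computable.fst.comp Computable.fst) Computable.snd)
      (Computable.const (some (encode ()))) (Computable.const none)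

theorem ceIn_largeSet (B : ℕ → Bool) (f : List ℕ) (l u : ℕ) {w : ℕ} (hw : 0 < w) :
    CEIn B (largeSet Φ B f l u w) := by
  refine ceIn_of_test (computable_largeTest Φ f l u w) fun g => ?_
  simp only [largeTest_initSeg Φ B f l u hw]
  exact ⟨fun h => ⟨g.sum, fun _ => List.le_sum_of_mem, h⟩, fun ⟨_, _, h⟩ => h⟩

/-- Supplies the threshold c as a quotient of natural numbers, so that `largeTest` only compares
integers. -/
theorem exists_nat_div_between {x y : ℝ} (hxy : x < y) (hy : 0 ≤ y) :
    ∃ u w : ℕ, 0 < w ∧ x < (u : ℝ) / w ∧ (u : ℝ) / w ≤ y := by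
  rcases lt_or_ge x 0 with hx | hx
  · exact ⟨0, 1, one_pos, by simpa using hx, by simpa using hy⟩
  obtain ⟨q, hq1, hq2⟩ := exists_rat_btwn hxy
  have hq : 0 ≤ q.num := Rat.num_nonneg.2 (by exact_mod_cast hx.trans hq1.le)
  have hcast : ((q.num.toNat : ℕ) : ℝ) / q.den = q := by
    rw [Rat.cast_def, ← Int.cast_natCast, Int.toNat_of_nonneg hq]
  exact ⟨q.num.toNat, q.den, q.den_pos, hcast ▸ hq1, hcast ▸ hq2.le⟩

variable {Φ} {B : ℕ → Bool}

/-- The strings of extensions of `p` contain a set that is c.e. in `B` and that contains the strings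
of densely many extensions of some condition below `p`. -/
theorem exists_ceIn_denseBelow (hΦ : Φ.Standard) (p : Condition Φ B) :
    ∃ S : Set (List ℕ), CEIn B S ∧ (∀ g ∈ S, ∃ q ≤ p, q.str = g) ∧
      ∃ p' ≤ p, DenseBelow p' {q | q ≤ p' ∧ q.str ∈ S} := by
  have hp : (0 : ℝ) < p.eps := by exact_mod_cast p.eps_pos
  set m := cantorMeasure.real (dom Φ B) with hm
  obtain ⟨n₀, hn₀⟩ := exists_forall_conv_diff_dom_lt B hΦ (δ := (p.eps : ℝ) / 4) (by positivity)
  -- The lower bound makes members of S extend `p`; the upper bound lets long strings below the new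
  -- condition enter S. The maximum with 0 covers m < ε/2.
  obtain ⟨u, w, hw, hu1, hu2⟩ := exists_nat_div_between
    (x := m - 3 * p.eps / 4) (y := max 0 (m - p.eps / 2))
    (lt_max_of_lt_right (by linarith)) (le_max_left _ _)
  refine ⟨largeSet Φ B p.str (n₀ + 1) u w, ceIn_largeSet Φ B _ _ _ hw, ?_,
    ⟨p.str, p.eps / 2, half_pos p.eps_pos⟩,
    ⟨List.prefix_rfl, (half_lt_self p.eps_pos).le, fun h => absurd rfl h⟩, fun q hq => ?_⟩
  · rintro g ⟨⟨hfg, hlen, hn⟩, hlarge⟩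
    have hD : bounded Φ B p.str.length g ⊆ conv Φ B (g.length - 1) :=
      bounded_subset_conv Φ B (by omega) (by omega)
    have hdom : dom Φ B ⊆ conv Φ B (g.length - 1) :=
      dom_eq_iInter_conv Φ B ▸ Set.iInter_subset _ _
    -- With C the set `conv` at the last index of g: μ(dom ∖ D) ≤ μ(C) − μ(D) < (m + ε/4) − (m −
    -- 3ε/4) = ε.
    have h1 := measureReal_mono (μ := cantorMeasure)
      (Set.sdiff_subset_sdiff_left (t := bounded Φ B p.str.length g) hdom)
    rw [measureReal_sdiff hD (measurableSet_bounded Φ B _ _)] at h1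
    have h2 := hn₀ (g.length - 1) (by omega)
    rw [measureReal_sdiff hdom (measurableSet_dom Φ B)] at h2
    obtain ⟨e, he0, he⟩ := exists_rat_btwn
      (show (0 : ℝ) < p.eps - cantorMeasure.real (dom Φ B \ bounded Φ B p.str.length g) by linarith)
    have hle : (e : ℝ) ≤ p.eps := by
      linarith [measureReal_nonneg (μ := cantorMeasure)
        (s := dom Φ B \ bounded Φ B p.str.length g)]
    exact ⟨⟨g, e, by exact_mod_cast he0⟩, ⟨hfg, by exact_mod_cast hle, fun _ => by
      change cantorMeasure.real (dom Φ B \ bounded Φ B p.str.length g) + (e : ℝ) < p.eps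
      linarith⟩, rfl⟩
  · obtain ⟨r, hr, hlen⟩ := q.exists_le_length (max (p.str.length + 1) (n₀ + 1))
    have hr' := hr.trans hq
    have hlt : p.str.length < r.str.length := (le_max_left _ _).trans hlen
    refine ⟨r, hr, hr', ⟨hr'.1, hlt, (le_max_right _ _).trans hlen⟩, hu2.trans ?_⟩
    refine max_le measureReal_nonneg ?_
    have h1 := hr'.2.2 fun h => hlt.ne (congrArg List.length h)
    dsimp only at h1
    push_cast at h1
    have h2 : (0 : ℝ) < r.eps := by exact_mod_cast r.eps_pos
    have h3 : m ≤ cantorMeasure.real (bounded Φ B p.str.length r.str) +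
        cantorMeasure.real (dom Φ B \ bounded Φ B p.str.length r.str) := by
      refine (measureReal_mono ?_).trans (measureReal_union_le _ _)
      exact fun Z hZ => or_iff_not_imp_left.2 fun h => ⟨hZ, h⟩
    linarith

/-! ### Selecting values by search -/

theorem take_initSeg {α : Type*} (X : ℕ → α) {s t : ℕ} (h : s ≤ t) :
    (initSeg X t).take s = initSeg X s := by
  have := List.prefix_iff_eq_take.1 (initSeg_prefix X h)
  rw [length_initSeg] at this
  exact this.symm

/-- If every `n` is assigned some value by `R` on some initial segment of `X`, then `X` computes a
function that selects such values. -/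
theorem exists_computableIn_selection {R : List ℕ → ℕ → Option ℕ} (hR : Computable₂ R) {X : ℕ → ℕ}
    (h : ∀ n, ∃ s v, R (initSeg X s) n = some v) :
    ∃ f : ℕ → ℕ, ComputableIn (oracle X) f ∧ ∀ n, ∃ s, R (initSeg X s) n = some (f n) := by
  classical
  have hsome : ∀ n, ∃ s, (R (initSeg X s) n).isSome := fun n => by
    obtain ⟨s, v, hv⟩ := h n
    exact ⟨s, by simp [hv]⟩
  choose f hf using fun n => Option.isSome_iff_exists.1 (Nat.find_spec (hsome n))
  refine ⟨f, RecursiveIn.iff_nat.2 ?_, fun n => ⟨_, hf n⟩⟩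
  have hc : Computable₂ fun (p : List ℕ × ℕ) (s : ℕ) => R (p.1.take s) p.2 :=
    hR.comp (Primrec.list_take.to_comp.comp Computable.snd (Computable.fst.comp Computable.fst))
      (Computable.snd.comp Computable.fst)
  -- `R` may give different values at different stages, so the value at the least successful stage
  -- is taken. The range includes s = |σ|.
  refine Computes.recursiveIn (R := fun σ n => ((List.range (σ.length + 1)).find?
    fun s => (R (σ.take s) n).isSome).bind fun s => R (σ.take s) n)
    ⟨fun {t n v} hv => ?_, fun {n v} hv => ?_⟩ ?_
  · obtain ⟨s, hs, hv⟩ := Option.bind_eq_some_iff.1 hv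
    obtain ⟨hs1, hs2, hs3⟩ := List.find?_range_eq_some.1 hs
    rw [length_initSeg, List.mem_range, Nat.lt_succ_iff] at hs2
    rw [take_initSeg X hs2] at hs1 hv
    have : Nat.find (hsome n) = s := (Nat.find_eq_iff _).2 ⟨hs1, fun j hj => by
      have := hs3 j hj
      rw [take_initSeg X (hj.le.trans hs2)] at this
      simpa using this⟩
    have h' := hf n
    rw [this, hv] at h'
    simpa using h'
  · obtain rfl := Part.mem_some_iff.1 hv
    refine ⟨Nat.find (hsome n), Option.bind_eq_some_iff.2 ⟨Nat.find (hsome n),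
      List.find?_range_eq_some.2 ⟨?_, by simp, fun j hj => ?_⟩, ?_⟩⟩
    · rw [take_initSeg X le_rfl]
      exact Nat.find_spec (hsome n)
    · rw [take_initSeg X hj.le]
      simpa using Nat.find_min (hsome n) hj
    · rw [take_initSeg X le_rfl]
      exact hf n
  · exact Computable.option_bind (α := List ℕ × ℕ)
      (computable_find_range (Primrec.option_isSome.to_comp.comp hc).to₂
        (Computable.succ.comp (Computable.list_length.comp Computable.fst))) hc

/-! ### Oracle computations from conditions -/

/-- The longest initial segment of `B ⊕ f` that is determined by the initial segment `g` of `f`. -/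
def strOracle (B : ℕ → Bool) (g : List ℕ) : List ℕ :=
  initSeg (join (charFn B) fun i => g.getD i 0) (2 * g.length)

theorem strOracle_initSeg (B : ℕ → Bool) (f : ℕ → ℕ) (m : ℕ) :
    strOracle B (initSeg f m) = initSeg (join (charFn B) f) (2 * m) := by
  rw [strOracle, length_initSeg]
  refine initSeg_congr fun i hi => ?_
  simp only [join]
  split_ifs
  · rfl
  · rw [List.getD_eq_getElem?_getD, getElem?_initSeg f (by omega), Option.getD_some]

theorem strOracle_prefix (B : ℕ → Bool) {g g' : List ℕ} (h : g <+: g') :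
    strOracle B g <+: strOracle B g' := by
  have : g = initSeg (fun i => g'.getD i 0) g.length := by
    refine List.ext_getElem (by simp) fun i hi _ => ?_
    simp [initSeg, h.getElem hi, List.getElem?_eq_getElem (hi.trans_le h.length_le)]
  rw [this, strOracle_initSeg, strOracle]
  exact initSeg_prefix _ (by have := h.length_le; omega)

/-- `strOracle` as a function of an initial segment of the set. -/
def joinStr (σ g : List ℕ) : List ℕ :=
  (List.range (2 * g.length)).map fun i =>
    if i % 2 = 0 then σ.getD (i / 2) 0 else g.getD (i / 2) 0

theorem joinStr_initSeg (B : ℕ → Bool) {g : List ℕ} {s : ℕ} (h : g.length ≤ s) :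
    joinStr (initSeg (charFn B) s) g = strOracle B g := by
  refine List.map_congr_left fun i hi => ?_
  have hi' := List.mem_range.1 hi
  simp only [join]
  rw [List.getD_eq_getElem?_getD, getElem?_initSeg _ (by omega), Option.getD_some]

theorem primrec_joinStr : Primrec₂ joinStr := by
  have hhalf : Primrec fun q : (List ℕ × List ℕ) × ℕ => q.2 / 2 :=
    Primrec.nat_div.comp Primrec.snd (Primrec.const 2)
  refine Primrec.list_map (α := List ℕ × List ℕ) (Primrec.list_range.comp
    (Primrec.nat_mul.comp (Primrec.const 2) (Primrec.list_length.comp Primrec.snd))) ?_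
  exact Primrec.ite (α := (List ℕ × List ℕ) × ℕ)
    (Primrec.eq.comp (Primrec.nat_mod.comp Primrec.snd (Primrec.const 2)) (Primrec.const 0))
    ((Primrec.list_getD 0).comp (Primrec.fst.comp Primrec.fst) hhalf)
    ((Primrec.list_getD 0).comp (Primrec.snd.comp Primrec.fst) hhalf)

theorem CEIn.exists_approx {B : ℕ → Bool} {S : Set (List ℕ)} (hS : CEIn B S) :
    ∃ T, IsApprox T ∧ ∀ g, g ∈ S ↔ ∃ s, (T (initSeg (charFn B) s) (encode g)).isSome := by
  obtain ⟨T, hT, hf⟩ := AEDomination.exists_approx hS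
  refine ⟨T, hT, fun g => ⟨fun hg => ?_, fun ⟨s, hs⟩ => ?_⟩⟩
  · obtain ⟨s, hs⟩ := hf.complete (n := encode g) (v := encode ()) (by
      simpa [hg] using ⟨(), rfl⟩)
    exact ⟨s, by simp [hs]⟩
  · obtain ⟨v, hv⟩ := Option.isSome_iff_exists.1 hs
    have := hf.sound hv
    simp only [encodek, Part.coe_some, Part.bind_some, Part.mem_map_iff, Part.mem_assert_iff] at this
    exact this.choose_spec.1.1

/-- If every `n` is assigned some value by `T` on `B ⊕ g` for some `g` in a set `S` that is c.e. in
`B`, then `B` computes a function that selects such values. -/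
theorem exists_computableIn_of_ceIn {B : ℕ → Bool} {S : Set (List ℕ)} (hS : CEIn B S)
    {T : List ℕ → ℕ → Option ℕ} (hT : IsApprox T)
    (h : ∀ n, ∃ g ∈ S, ∃ v, T (strOracle B g) n = some v) :
    ∃ f : ℕ → ℕ, ComputableIn (oracle (charFn B)) f ∧
      ∀ n, ∃ g ∈ S, T (strOracle B g) n = some (f n) := by
  obtain ⟨U, hU, hSU⟩ := hS.exists_approx
  -- The length of σ is read as a pair whose second entry codes the candidate g, so each g is tried
  -- at arbitrarily late stages. Since |g| is at most its code, σ always determines `B ⊕ g` up to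
  -- 2|g|.
  let R : List ℕ → ℕ → Option ℕ := fun σ n =>
    (decode (α := List ℕ) σ.length.unpair.2).bind fun g =>
      (U σ (encode g)).bind fun _ => T (joinStr σ g) n
  have hR : Computable₂ R := by
    refine Computable.option_bind (α := List ℕ × ℕ) (Computable.decode.comp (Computable.snd.comp
      (Computable.unpair.comp (Computable.list_length.comp Computable.fst)))) ?_
    refine Computable.option_bind (α := (List ℕ × ℕ) × List ℕ) (hU.computable.comp
      (Computable.fst.comp Computable.fst) (Computable.encode.comp Computable.snd)) ?_
    have h1 : Computable fun q : ((List ℕ × ℕ) × List ℕ) × ℕ => q.1 := Computable.fst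
    exact hT.computable.comp (primrec_joinStr.to_comp.comp
      (Computable.fst.comp (Computable.fst.comp h1)) (Computable.snd.comp h1))
      (Computable.snd.comp (Computable.fst.comp h1))
  have hsel : ∀ n, ∃ s v, R (initSeg (charFn B) s) n = some v := fun n => by
    obtain ⟨g, hg, v, hv⟩ := h n
    obtain ⟨s, hs⟩ := (hSU g).1 hg
    obtain ⟨x, hx⟩ := Option.isSome_iff_exists.1 hs
    refine ⟨Nat.pair s (encode g), v, ?_⟩
    have hx' := hU.mono_initSeg (charFn B) (Nat.left_le_pair s (encode g)) hx
    have hlen : g.length ≤ Nat.pair s (encode g) :=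
      (Encodable.length_le_encode g).trans (Nat.right_le_pair _ _)
    simp only [R, length_initSeg, Nat.unpair_pair, encodek, Option.bind_some, hx',
      joinStr_initSeg B hlen, hv]
  obtain ⟨f, hf, hfR⟩ := exists_computableIn_selection hR hsel
  refine ⟨f, hf, fun n => ?_⟩
  obtain ⟨s, hs⟩ := hfR n
  obtain ⟨g, hg, hs⟩ := Option.bind_eq_some_iff.1 hs
  obtain ⟨x, hx, hs⟩ := Option.bind_eq_some_iff.1 hs
  have hlen : g.length ≤ s := by
    rw [length_initSeg] at hg
    have h1 : s.unpair.2 = encode g := by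
      rw [← Denumerable.encode_ofNat (α := List ℕ) s.unpair.2]
      congr 1
      simpa using hg
    exact (Encodable.length_le_encode g).trans (h1 ▸ Nat.unpair_right_le s)
  rw [joinStr_initSeg B hlen] at hs
  exact ⟨g, (hSU g).2 ⟨s, by simp [hx]⟩, hs⟩

/-! ### Generic functions -/

section Generic

variable {Φ : Functional} {B : ℕ → Bool}

/-- The conditions that force `T` to compute a bad value or to diverge somewhere on `B ⊕ f^G`. -/
def decides (Φ : Functional) (B : ℕ → Bool) (bad : ℕ → ℕ → Prop) (T : List ℕ → ℕ → Option ℕ) :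
    Set (Condition Φ B) :=
  {q | (∃ n v, T (strOracle B q.str) n = some v ∧ bad n v) ∨
    ∃ n, ∀ r ≤ q, T (strOracle B r.str) n = none}

theorem isDense_decides (hΦ : Φ.Standard) {bad : ℕ → ℕ → Prop}
    (hB : ¬ ∃ h : ℕ → ℕ, (∀ n, ¬ bad n (h n)) ∧ ComputableIn (oracle (charFn B)) h)
    {T : List ℕ → ℕ → Option ℕ} (hT : IsApprox T) : IsDense (decides Φ B bad T) := by
  intro p
  obtain ⟨S, hS, hSp, p', hp', hdense⟩ := exists_ceIn_denseBelow hΦ p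
  by_cases hbad : ∃ g ∈ S, ∃ n v, T (strOracle B g) n = some v ∧ bad n v
  · obtain ⟨g, hg, h⟩ := hbad
    obtain ⟨q, hq, rfl⟩ := hSp g hg
    exact ⟨q, hq, Or.inl h⟩
  refine ⟨p', hp', Or.inr ?_⟩
  -- If no n is forced to diverge, then below some r computing at n there is a condition with string
  -- in S, and it inherits the computation. As S yields no bad value, the selected function avoids
  -- all of them.
  by_contra! hdiv
  refine hB ?_
  obtain ⟨f, hf, h⟩ := exists_computableIn_of_ceIn hS hT fun n => by
    obtain ⟨r, hr, hrn⟩ := hdiv n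
    obtain ⟨v, hv⟩ := Option.ne_none_iff_exists'.1 hrn
    obtain ⟨q, hq, -, hqS⟩ := hdense r hr
    exact ⟨q.str, hqS, v, hT.mono (strOracle_prefix B hq.1) hv⟩
  refine ⟨f, fun n hn => ?_, hf⟩
  obtain ⟨g, hg, hv⟩ := h n
  exact hbad ⟨g, hg, n, f n, hv, hn⟩

theorem exists_isGenericFunction (G : Order.PFilter (Condition Φ B))
    (hG : ∀ n, ∃ p ∈ G, n ≤ p.str.length) : ∃ f, IsGenericFunction G f := by
  have hex : ∀ n, ∃ m, ∃ p ∈ G, p.str[n]? = some m := fun n => by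
    obtain ⟨p, hp, hn⟩ := hG (n + 1)
    exact ⟨p.str[n], p, hp, List.getElem?_eq_getElem hn⟩
  choose f hf using hex
  refine ⟨f, fun n m => ⟨fun h => h ▸ hf n, fun ⟨q, hq, hm⟩ => ?_⟩⟩
  obtain ⟨p, hp, hfn⟩ := hf n
  obtain ⟨r, -, hrp, hrq⟩ := G.directed p hp q hq
  have key : ∀ {x : Condition Φ B} {k : ℕ}, r ≤ x → x.str[n]? = some k → r.str[n]? = some k := by
    intro x k hrx hk
    obtain ⟨hn, rfl⟩ := List.getElem?_eq_some_iff.1 hk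
    obtain ⟨t, ht⟩ := hrx.1
    rw [← ht, List.getElem?_append_left hn, List.getElem?_eq_getElem hn]
  exact Option.some_injective _ ((key hrp hfn).symm.trans (key hrq hm))

theorem IsGenericFunction.str_eq {G : Order.PFilter (Condition Φ B)} {f : ℕ → ℕ}
    (hf : IsGenericFunction G f) {p : Condition Φ B} (hp : p ∈ G) :
    p.str = initSeg f p.str.length := by
  refine List.ext_getElem (by simp) fun i hi _ => ?_
  have := (hf i p.str[i]).2 ⟨p, hp, List.getElem?_eq_getElem hi⟩
  simp [initSeg, this]

/-- If `B` computes no function that avoids all bad values, then neither does `B ⊕ f^G` for generic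
`G`. -/
theorem forSufficientlyGeneric_not_computableIn (hΦ : Φ.Standard) {bad : ℕ → ℕ → Prop}
    (hB : ¬ ∃ h : ℕ → ℕ, (∀ n, ¬ bad n (h n)) ∧ ComputableIn (oracle (charFn B)) h) :
    ForSufficientlyGeneric fun G : Order.PFilter (Condition Φ B) =>
      ∃ f : ℕ → ℕ, IsGenericFunction G f ∧
        ¬ ∃ h : ℕ → ℕ, (∀ n, ¬ bad n (h n)) ∧ ComputableIn (oracle (join (charFn B) f)) h := by
  refine ⟨(decides Φ B bad '' {T | IsApprox T}) ∪
    Set.range fun n => {q : Condition Φ B | n ≤ q.str.length},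
    (countable_isApprox.image _).union (Set.countable_range _), ?_, fun G hG => ?_⟩
  · rintro D (⟨T, hT, rfl⟩ | ⟨n, rfl⟩)
    · exact isDense_decides hΦ hB hT
    · exact fun p => p.exists_le_length n
  have hlen : ∀ n, ∃ p ∈ G, n ≤ p.str.length := fun n => hG _ (Or.inr ⟨n, rfl⟩)
  obtain ⟨f, hf⟩ := exists_isGenericFunction G hlen
  refine ⟨f, hf, fun ⟨h, hbad, hcomp⟩ => ?_⟩
  obtain ⟨T, hT, hTh⟩ := exists_approx (RecursiveIn.iff_nat.1 hcomp.recursiveIn)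
  have hstr : ∀ p ∈ G, strOracle B p.str = initSeg (join (charFn B) f) (2 * p.str.length) :=
    fun p hp => (congrArg _ (hf.str_eq hp)).trans (strOracle_initSeg B f _)
  obtain ⟨q, hq, ⟨n, v, hv, hb⟩ | ⟨n, hn⟩⟩ := hG _ (Or.inl ⟨T, hT, rfl⟩)
  · rw [hstr q hq] at hv
    obtain rfl := Part.mem_some_iff.1 (hTh.sound hv)
    exact hbad n hb
  -- The computation at n uses a finite part of `B ⊕ f`; a common extension in `G` of `q` and a long
  -- enough condition already shows it, against the forced divergence.
  · obtain ⟨s, hs⟩ := hTh.complete (Part.mem_some (h n))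
    obtain ⟨p, hp, hsp⟩ := hlen s
    obtain ⟨r, hr, hrp, hrq⟩ := G.directed p hp q hq
    have hle : s ≤ 2 * r.str.length := by have := hrp.1.length_le; omega
    have := hn r hrq
    rw [hstr r hr, hT.mono_initSeg _ hle hs] at this
    exact absurd this (Option.some_ne_none _)

end Generic

/-! ### DNR degrees and PA degrees -/

theorem hasDNRDegree_iff (X : ℕ → ℕ) : HasDNRDegree X ↔
    ∃ h : ℕ → ℕ, (∀ e, ¬ h e ∈ (Denumerable.ofNat Nat.Partrec.Code e).eval e) ∧
      ComputableIn (oracle X) h := Iff.rfl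

/-- Puts extending ψ into the form "avoids all bad values": v is bad at n unless it codes a bit
compatible with ψ(n). The double negation matches `¬ bad n (h n)` literally. -/
theorem exists_extension_iff (ψ : ℕ →. Bool) (X : ℕ → ℕ) :
    (∃ h : ℕ → Bool, (∀ n, ∀ v ∈ ψ n, h n = v) ∧ ComputableIn (oracle X) h) ↔
      ∃ h : ℕ → ℕ, (∀ n, ¬ ¬ ∃ b : Bool, h n = encode b ∧ ∀ v ∈ ψ n, b = v) ∧
        ComputableIn (oracle X) h := by
  have hcode : ∀ h : ℕ → Bool, ComputableIn (oracle X) h ↔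
      ComputableIn (oracle X) fun n => encode (h n) := fun h => by
    simp [ComputableIn, RecursiveIn]
  simp only [not_not]
  constructor
  · rintro ⟨h, hψ, hc⟩
    exact ⟨fun n => encode (h n), fun n => ⟨h n, rfl, hψ n⟩, (hcode h).1 hc⟩
  · rintro ⟨h', hψ, hc⟩
    choose h hh hψ using hψ
    obtain rfl : h' = fun n => encode (h n) := funext hh
    exact ⟨h, hψ, (hcode h).2 hc⟩

end AEDomination

theorem mainTheorem6 (Φ : Functional) (hΦ : Φ.Standard) (B : ℕ → Bool) :
    -- the technical lemma
    (∀ p : Condition Φ B, ∃ S : Set (List ℕ), CEIn B S ∧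
      (∀ g ∈ S, ∃ q ≤ p, q.str = g) ∧
      ∃ p' ≤ p, DenseBelow p' {q | q ≤ p' ∧ q.str ∈ S}) ∧
    -- non-DNR degrees are preserved
    (¬ HasDNRDegree (charFn B) →
      ForSufficientlyGeneric fun G : Order.PFilter (Condition Φ B) =>
        ∃ f : ℕ → ℕ, IsGenericFunction G f ∧ ¬ HasDNRDegree (join (charFn B) f)) ∧
    -- non-PA degrees are preserved
    (¬ HasPADegree (charFn B) →
      ForSufficientlyGeneric fun G : Order.PFilter (Condition Φ B) =>
        ∃ f : ℕ → ℕ, IsGenericFunction G f ∧ ¬ HasPADegree (join (charFn B) f)) := by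
  refine ⟨exists_ceIn_denseBelow hΦ, fun hB => ?_, fun hB => ?_⟩
  · simp only [hasDNRDegree_iff] at hB ⊢
    exact forSufficientlyGeneric_not_computableIn hΦ hB
  -- A single ψ with no extension computable in `B` is fixed before `G`; it then witnesses failure
  -- for every generic f.
  · obtain ⟨ψ, hψ, hno⟩ : ∃ ψ : ℕ →. Bool, Partrec ψ ∧
        ¬ ∃ h : ℕ → Bool, (∀ n, ∀ v ∈ ψ n, h n = v) ∧ ComputableIn (oracle (charFn B)) h := by
      simpa only [HasPADegree, not_forall, exists_prop] using hB
    rw [exists_extension_iff] at hno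
    obtain ⟨𝒟, hc, hd, hG⟩ := forSufficientlyGeneric_not_computableIn hΦ
      (bad := fun n v => ¬ ∃ b : Bool, v = Encodable.encode b ∧ ∀ w ∈ ψ n, b = w) hno
    refine ⟨𝒟, hc, hd, fun G h => ?_⟩
    obtain ⟨f, hf, hf'⟩ := hG G h
    exact ⟨f, hf, fun hPA => hf' ((exists_extension_iff ψ _).1 (hPA ψ hψ))⟩
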